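/- Let $1\le k\le n$ be integers, $\alpha>0$ and $\lambda\in(0,1)$. Let $p_1,\dots,p_n$ be independent real random variables (the $p$-values of null hypotheses $H_1,\dots,H_n$), and let $I_0\subseteq\{1,\dots,n\}$ be the set of indices of the true null hypotheses; assume that $p_i$ is uniformly distributed on $(0,1)$ for every $i\in I_0$. No assumption is made on the laws of the other $p_i$. For $0<t<1$ put $$\tilde G_{k,n}(t)=t\sum_{m=k-1}^{n-1}\binom{n-1}{m}t^m(1-t)^{n-1-m},$$ an increasing bijection of $(0,1)$ onto itself, and let $\tilde G_{k,n}^{-1}$ be its inverse, with the convention $\tilde G_{k,n}^{-1}(y)=y$ for $y\ge 1$. Let $p_{1:n}\le\dots\le p_{n:n}$ be the sorted $p$-values and $H_{(i)}$ the null hypothesis corresponding to $p_{i:n}$. Consider the following two-stage procedure. First find $$j=\max\{1\le i\le n:\ p_{i:n}\le\lambda\},$$ then reject $H_{(1)},\dots,H_{(\hat l)}$, where $$\hat l=\max\Bigl\{1\le i\le j:\ p_{i:n}\le\lambda\min\Bigl[\tilde G_{k,n}^{-1}\Bigl(\frac{i\alpha(1-\lambda)}{\lambda(n-j+1)}\Bigr),1\Bigr]\Bigr\};$$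 if the maximum does not exist at either stage, reject nothing. Let $R$ be the number of rejected hypotheses and $V$ the number of rejected true null hypotheses. Then the procedure controls the $k$-FDR at level $\alpha$, that is, $$k\text{-FDR}=E\left[\frac{V\,\mathbf 1(V\ge k)}{\max(R,1)}\right]\le\alpha .$$ -/

import Mathlib

open MeasureTheory ProbabilityTheory

noncomputable section

namespace KFDR

/-- The binomial upper tail `G(k, n, u) = ∑_{j=k}^n C(n,j) u^j (1-u)^(n-j)`. -/
def G (k n : ℕ) (u : ℝ) : ℝ :=
  ∑ j ∈ Finset.Icc k n, (n.choose j : ℝ) * u ^ j * (1 - u) ^ (n - j)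

/-- The function `t ↦ t * G(k-1, n-1, t)`, considered on `(0, 1)`, for `1 ≤ k ≤ n`. -/
def Gtilde (k n : ℕ) (t : ℝ) : ℝ :=
  t * G (k - 1) (n - 1) t

/-- The inverse of `Gtilde k n`. For `1 ≤ k ≤ n`, `Gtilde k n` is an increasing bijection of
`(0, 1)` onto itself. Since the binomial tail is a distribution function, equal to `1` from `t = 1`
on, `Gtilde k n` extends to the identity on `[1, ∞)`, and so does its inverse. -/
def GtildeInv (k n : ℕ) (y : ℝ) : ℝ :=
  if y < 1 then Function.invFunOn (Gtilde k n) (Set.Ioo 0 1) y else y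

/-- `H_(i+1)`: the index of the hypothesis with the `(i+1)`-th smallest p-value (ranks are counted
from `0` here). -/
def ranked {n : ℕ} (p : Fin n → ℝ) (i : Fin n) : Fin n :=
  Tuple.sort p i

/-- `p_{i+1:n}`: the `(i+1)`-th smallest p-value. -/
def orderStat {n : ℕ} (p : Fin n → ℝ) (i : Fin n) : ℝ :=
  p (ranked p i)

/-- The first stage: `j = max {1 ≤ i ≤ n : p_{i:n} ≤ lam}`, with `0` if there is no such `i`. -/
def firstStage {n : ℕ} (lam : ℝ) (p : Fin n → ℝ) : ℕ :=
  (Finset.univ.filter fun i : Fin n => orderStat p i ≤ lam).sup fun i => (i : ℕ) + 1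

/-- The critical values
`lam * min [GtildeInv (i * α * (1 - lam) / (lam * (n - j + 1))), 1]`. -/
def crit (k n : ℕ) (α lam : ℝ) (i j : ℕ) : ℝ :=
  lam * min (GtildeInv k n ((i : ℝ) * α * (1 - lam) / (lam * ((n : ℝ) - (j : ℝ) + 1)))) 1

/-- The second stage: the largest `1 ≤ i ≤ j` such that `p_{i:n}` is at most the `i`-th critical
value, with `0` if there is no such `i`. -/
def secondStage {n : ℕ} (k : ℕ) (α lam : ℝ) (p : Fin n → ℝ) : ℕ :=
  (Finset.univ.filter fun i : Fin n =>
    (i : ℕ) + 1 ≤ firstStage lam p ∧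
      orderStat p i ≤ crit k n α lam ((i : ℕ) + 1) (firstStage lam p)).sup fun i => (i : ℕ) + 1

/-- The set of hypotheses rejected by the two-stage adaptive procedure, `H_(1), …, H_(l)` with
`l = secondStage k α lam p`. -/
def rejected {n : ℕ} (k : ℕ) (α lam : ℝ) (p : Fin n → ℝ) : Finset (Fin n) :=
  (Finset.univ.filter fun i : Fin n => (i : ℕ) < secondStage k α lam p).image (ranked p)

/-- The `k`-FDP `V 1(V ≥ k) / max(R, 1)` of a rejection set `rej`, where `nulls` is the set of true
null hypotheses, `V = #(rej ∩ nulls)` and `R = #rej`. -/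
def kFDP {n : ℕ} (k : ℕ) (nulls rej : Finset (Fin n)) : ℝ :=
  (if k ≤ (rej ∩ nulls).card then ((rej ∩ nulls).card : ℝ) else 0) / max (rej.card : ℝ) 1

/-- A multiple testing procedure `proc`, applied to the random p-values `p` with true nulls
`nulls`, controls the `k`-FDR at level `α`: the `k`-FDP has an expectation and it is at most `α`. -/
def ControlsKFDR {Ω : Type*} [MeasurableSpace Ω] (μ : Measure Ω) {n : ℕ} (k : ℕ) (α : ℝ)
    (nulls : Finset (Fin n)) (p : Fin n → Ω → ℝ)
    (proc : (Fin n → ℝ) → Finset (Fin n)) : Prop :=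
  Integrable (fun ω => kFDP k nulls (proc fun i => p i ω)) μ ∧
    ∫ ω, kFDP k nulls (proc fun i => p i ω) ∂μ ≤ α

end KFDR

end

namespace KFDR

/-! Fix the set `W` of p-values at most `lam`. On this event `j = #W`, so the second stage is a
step-up procedure with fixed critical values `c r`. Let `N` be the nulls in `W`, `A r` the event of
at least `r` rejections, and `φ r` the mean of `v 1(v ≥ k)` for `v` binomial with parameters `#N`
and `c r / lam`. Since `#N ≤ n`, the choice of `c r` gives `φ r ≤ γ * #N * r` with `γ = α (1 - lam)
/ (lam (n - #W + 1))`, so the factor `1 / r` in the k-FDP is at most `γ * #N / φ r`.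

The key is a correlation inequality, `wtIntegral_mul_le`. Integrate over `A (r + 1)` the weight of
the number of coordinates of `N` at most `c r`, and divide by `φ r`; passing to `c (r + 1)` and `φ
(r + 1)` does not increase the quotient. Indeed `A (r + 1)` tilts the number of small coordinates
upwards in likelihood ratio (`measureReal_exchange`), while independent thinning from `c (r + 1)` to
`c r` (`measureReal_thinning`) gives relatively more weight to large numbers. The sum over `r` then
telescopes, and the contribution of `W` is at most `γ * #N * P(W)` (`sum_wtIntegral_sub_le`).

Finally `n - #W` is at least the number of nulls above `lam`, so the sum over `W` is bounded by a
binomial mean, computed in `sum_powerset_ratio_le`, which yields `α`. -/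

/-! ### Binomial tails -/

lemma G_zero (n : ℕ) (u : ℝ) : G 0 n u = 1 := by
  have h := add_pow u (1 - u) n
  rw [add_sub_cancel, one_pow] at h
  rw [h, G, ← Nat.range_succ_eq_Icc_zero]
  exact Finset.sum_congr rfl fun i _ => by ring

lemma G_of_lt {m n : ℕ} (h : n < m) (u : ℝ) : G m n u = 0 := by
  rw [G, Finset.Icc_eq_empty (by omega), Finset.sum_empty]

/-- Conditioning on one trial (Pascal's rule); both monotonicity properties of `G` follow from this
recursion. -/
lemma G_succ_succ (m n : ℕ) (u : ℝ) :
    G (m + 1) (n + 1) u = u * G m n u + (1 - u) * G (m + 1) n u := by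
  have shift : ∀ f : ℕ → ℝ, ∑ i ∈ Finset.Icc (m + 1) (n + 1), f i
      = ∑ i ∈ Finset.Icc m n, f (i + 1) := fun f => by
    rw [← Finset.map_add_right_Icc m n 1, Finset.sum_map]
    rfl
  have hlast : G (m + 1) n u
      = ∑ j ∈ Finset.Icc (m + 1) (n + 1), (n.choose j : ℝ) * u ^ j * (1 - u) ^ (n - j) := by
    rw [G]
    refine Finset.sum_subset (Finset.Icc_subset_Icc_right (by omega)) fun i hi hi' => ?_
    have : i = n + 1 := by
      simp only [Finset.mem_Icc] at hi hi'
      omega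
    simp [this]
  rw [hlast, G, G, shift, shift, Finset.mul_sum, Finset.mul_sum, ← Finset.sum_add_distrib]
  refine Finset.sum_congr rfl fun i hi => ?_
  have hi' : i ≤ n := (Finset.mem_Icc.1 hi).2
  rw [Nat.choose_succ_succ, Nat.add_sub_add_right]
  rcases hi'.eq_or_lt with rfl | h
  · simp
    ring
  · have : n - i = (n - (i + 1)) + 1 := by omega
    rw [this]
    push_cast
    ring

lemma G_nonneg (m n : ℕ) {u : ℝ} (h0 : 0 ≤ u) (h1 : u ≤ 1) : 0 ≤ G m n u :=
  Finset.sum_nonneg fun i _ => by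
    have : 0 ≤ 1 - u := by linarith
    positivity

lemma G_succ_le (m n : ℕ) {u : ℝ} (h0 : 0 ≤ u) (h1 : u ≤ 1) : G (m + 1) n u ≤ G m n u := by
  refine Finset.sum_le_sum_of_subset_of_nonneg (Finset.Icc_subset_Icc_left (by omega))
    fun i _ _ => ?_
  have : 0 ≤ 1 - u := by linarith
  positivity

lemma G_le_succ (m n : ℕ) {u : ℝ} (h0 : 0 ≤ u) (h1 : u ≤ 1) : G m n u ≤ G m (n + 1) u := by
  cases m with
  | zero => rw [G_zero, G_zero]
  | succ m =>
    rw [G_succ_succ]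
    nlinarith [G_succ_le m n h0 h1]

lemma G_mono_right (m : ℕ) {u : ℝ} (h0 : 0 ≤ u) (h1 : u ≤ 1) : Monotone fun n => G m n u :=
  monotone_nat_of_le_succ fun n => G_le_succ m n h0 h1

lemma G_monotoneOn (m n : ℕ) : MonotoneOn (G m n) (Set.Icc 0 1) := by
  induction n generalizing m with
  | zero =>
    cases m with
    | zero => exact fun x _ y _ _ => by rw [G_zero, G_zero]
    | succ m => exact fun x _ y _ _ => by rw [G_of_lt (by omega), G_of_lt (by omega)]
  | succ n ih =>
    cases m with
    | zero => exact fun x _ y _ _ => by rw [G_zero, G_zero]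
    | succ m =>
      intro x hx y hy hxy
      rw [G_succ_succ, G_succ_succ]
      have h1 := ih m hx hy hxy
      have h2 := ih (m + 1) hx hy hxy
      have h3 := G_succ_le m n hx.1 hx.2
      have e1 := mul_le_mul_of_nonneg_left h1 hy.1
      have e2 := mul_le_mul_of_nonneg_left h2 (sub_nonneg.2 hy.2)
      -- Raising the success probability of the distinguished trial from `x` to `y` moves mass to
      -- the larger tail.
      have e3 := mul_nonneg (sub_nonneg.2 hxy) (sub_nonneg.2 h3)
      nlinarith

lemma G_pos {m n : ℕ} (h : m ≤ n) {u : ℝ} (h0 : 0 < u) (h1 : u ≤ 1) : 0 < G m n u := by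
  refine Finset.sum_pos' (fun i _ => ?_) ⟨n, Finset.mem_Icc.2 ⟨h, le_rfl⟩, ?_⟩
  · have : 0 ≤ 1 - u := by linarith
    positivity
  · simp only [Nat.choose_self, Nat.sub_self, pow_zero]
    positivity

lemma G_one {m n : ℕ} (h : m ≤ n) : G m n 1 = 1 := by
  rw [G, Finset.sum_eq_single_of_mem n (Finset.mem_Icc.2 ⟨h, le_rfl⟩)]
  · simp
  · intro i hi hne
    have : n - i ≠ 0 := by
      have := (Finset.mem_Icc.1 hi).2
      omega
    simp [this]

/-! ### The inverse of `Gtilde` and its cap -/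

lemma continuous_Gtilde (k n : ℕ) : Continuous (Gtilde k n) := by
  unfold Gtilde G
  fun_prop

lemma Gtilde_monotoneOn (k n : ℕ) : MonotoneOn (Gtilde k n) (Set.Icc 0 1) := fun _ hx _ hy hxy =>
  mul_le_mul hxy (G_monotoneOn _ _ hx hy hxy) (G_nonneg _ _ hx.1 hx.2) hy.1

lemma GtildeInv_spec {k n : ℕ} (hkn : k ≤ n) {y : ℝ} (h0 : 0 < y) (h1 : y < 1) :
    GtildeInv k n y ∈ Set.Ioo (0 : ℝ) 1 ∧ Gtilde k n (GtildeInv k n y) = y := by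
  have hex : ∃ t ∈ Set.Ioo (0 : ℝ) 1, Gtilde k n t = y := by
    have := intermediate_value_Ioo zero_le_one (continuous_Gtilde k n).continuousOn
    refine this ⟨?_, ?_⟩
    · simpa [Gtilde] using h0
    · rw [Gtilde, G_one (by omega)]
      simpa using h1
  rw [GtildeInv, if_pos h1]
  exact ⟨Function.invFunOn_mem hex, Function.invFunOn_eq hex⟩

/-- The inverse of `Gtilde k n`, capped at `1`. -/
noncomputable def cappedInv (k n : ℕ) (y : ℝ) : ℝ := min (GtildeInv k n y) 1

lemma cappedInv_of_one_le {k n : ℕ} {y : ℝ} (h : 1 ≤ y) : cappedInv k n y = 1 := by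
  rw [cappedInv, GtildeInv, if_neg (by linarith), min_eq_right h]

lemma cappedInv_of_lt_one {k n : ℕ} (hkn : k ≤ n) {y : ℝ} (h0 : 0 < y) (h1 : y < 1) :
    cappedInv k n y = GtildeInv k n y :=
  min_eq_left (GtildeInv_spec hkn h0 h1).1.2.le

lemma cappedInv_pos {k n : ℕ} (hkn : k ≤ n) {y : ℝ} (h0 : 0 < y) : 0 < cappedInv k n y := by
  rcases lt_or_ge y 1 with h | h
  · rw [cappedInv_of_lt_one hkn h0 h]
    exact (GtildeInv_spec hkn h0 h).1.1
  · rw [cappedInv_of_one_le h]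
    exact one_pos

lemma cappedInv_le_one (k n : ℕ) (y : ℝ) : cappedInv k n y ≤ 1 := min_le_right _ _

lemma Gtilde_cappedInv_le {k n : ℕ} (hkn : k ≤ n) {y : ℝ} (h0 : 0 < y) :
    Gtilde k n (cappedInv k n y) ≤ y := by
  rcases lt_or_ge y 1 with h | h
  · rw [cappedInv_of_lt_one hkn h0 h]
    exact (GtildeInv_spec hkn h0 h).2.le
  · rw [cappedInv_of_one_le h, Gtilde, G_one (by omega)]
    simpa using h

lemma cappedInv_mono {k n : ℕ} (hkn : k ≤ n) {y z : ℝ} (h0 : 0 < y) (hyz : y ≤ z) :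
    cappedInv k n y ≤ cappedInv k n z := by
  rcases lt_or_ge z 1 with h | h
  · rw [cappedInv_of_lt_one hkn h0 (hyz.trans_lt h), cappedInv_of_lt_one hkn (h0.trans_le hyz) h]
    obtain ⟨hy, ey⟩ := GtildeInv_spec hkn h0 (hyz.trans_lt h)
    obtain ⟨hz, ez⟩ := GtildeInv_spec hkn (h0.trans_le hyz) h
    rcases hyz.eq_or_lt with rfl | hlt
    · exact le_rfl
    · by_contra! hcon
      have := Gtilde_monotoneOn k n (Set.Ioo_subset_Icc_self hz) (Set.Ioo_subset_Icc_self hy) hcon.le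
      linarith
  · rw [cappedInv_of_one_le h]
    exact cappedInv_le_one _ _ _

/-! ### The truncated binomial mean -/

/-- The weight `v 1(v ≥ k)`. -/
noncomputable def wt (k v : ℕ) : ℝ := if k ≤ v then (v : ℝ) else 0

lemma wt_nonneg (k v : ℕ) : 0 ≤ wt k v := by
  unfold wt
  split_ifs <;> positivity

/-- The mean of `wt k` under the binomial law with parameters `v` and `u`. -/
noncomputable def binWt (k v : ℕ) (u : ℝ) : ℝ := v * (u * G (k - 1) (v - 1) u)

/-- The absorption identity `i * C(v, i) = v * C(v - 1, i - 1)` trades the weight for one trial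
fewer and the threshold `k - 1`. -/
lemma sum_range_wt {k : ℕ} (hk : 1 ≤ k) (v : ℕ) (u : ℝ) :
    ∑ i ∈ Finset.range (v + 1), (v.choose i : ℝ) * (wt k i * (u ^ i * (1 - u) ^ (v - i)))
      = binWt k v u := by
  cases v with
  | zero => simp [binWt, wt]
  | succ v =>
    rw [Finset.sum_range_succ', binWt, Nat.add_sub_cancel, G]
    have h0 : wt k 0 = 0 := by simp [wt]
    have hf : Finset.Icc (k - 1) v = (Finset.range (v + 1)).filter fun i => k - 1 ≤ i := by
      ext i
      simp only [Finset.mem_Icc, Finset.mem_filter, Finset.mem_range]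
      omega
    rw [h0, zero_mul, mul_zero, add_zero, hf, Finset.sum_filter, Finset.mul_sum, Finset.mul_sum]
    refine Finset.sum_congr rfl fun i _ => ?_
    have hc : ((v + 1).choose (i + 1) : ℝ) * (i + 1) = (v + 1) * v.choose i := by
      exact_mod_cast (Nat.add_one_mul_choose_eq v i).symm
    rw [Nat.add_sub_add_right, wt]
    by_cases h : k ≤ i + 1
    · rw [if_pos h, if_pos (by omega)]
      push_cast
      linear_combination (u ^ (i + 1) * (1 - u) ^ (v - i)) * hc
    · rw [if_neg h, if_neg (by omega)]
      simp

lemma sum_powerset_wt {ι : Type*} {k : ℕ} (hk : 1 ≤ k) (S : Finset ι) (u : ℝ) :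
    ∑ T ∈ S.powerset, wt k T.card * (u ^ T.card * (1 - u) ^ (S.card - T.card))
      = binWt k S.card u := by
  rw [Finset.sum_powerset_apply_card
    (fun m => wt k m * (u ^ m * (1 - u) ^ (S.card - m))), ← sum_range_wt hk]
  simp only [nsmul_eq_mul]

/-- For `k ≤ v` the ratio of `wt` to `binWt` is `1 / (u * G (k - 1) (v - 1) u)`, and the tail grows
with the number of trials. For `v < k` both sides vanish. -/
lemma wt_mul_binWt_le {k : ℕ} (hk : 1 ≤ k) {u : ℝ} (h0 : 0 ≤ u) (h1 : u ≤ 1) {v v' : ℕ}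
    (h : v ≤ v') : wt k v' * binWt k v u ≤ wt k v * binWt k v' u := by
  by_cases hv : k ≤ v
  · have hm : G (k - 1) (v - 1) u ≤ G (k - 1) (v' - 1) u :=
      G_mono_right (k - 1) h0 h1 (Nat.sub_le_sub_right h 1)
    rw [wt, wt, if_pos hv, if_pos (hv.trans h), binWt, binWt]
    have := mul_le_mul_of_nonneg_left hm (show 0 ≤ (v : ℝ) * v' * u by positivity)
    linarith
  · have hz : binWt k v u = 0 := by
      rcases Nat.eq_zero_or_pos v with rfl | hp
      · simp [binWt]
      · rw [binWt, G_of_lt (by omega)]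
        simp
    rw [hz, wt, wt, if_neg hv]
    simp

/-! ### Inequalities and identities for finite sums -/

/-- Chebyshev's sum inequality in ratio form: after symmetrisation the pair `(v, v')` contributes
`(w v * w' v' - w v' * w' v) * (K v' * L v - K v * L v')`, a product of two factors of the same
sign. -/
lemma sum_mul_sum_le_of_ratio {M : ℕ} {w w' K L : ℕ → ℝ}
    (hw : ∀ v v', v ≤ v' → v' ≤ M → w v' * w' v ≤ w v * w' v')
    (hK : ∀ v v', v ≤ v' → v' ≤ M → K v * L v' ≤ K v' * L v) :
    (∑ v ∈ Finset.range (M + 1), w v * K v) * (∑ v ∈ Finset.range (M + 1), w' v * L v)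
      ≤ (∑ v ∈ Finset.range (M + 1), w v * L v) * (∑ v ∈ Finset.range (M + 1), w' v * K v) := by
  rw [Finset.sum_mul_sum, Finset.sum_mul_sum, ← sub_nonneg, ← Finset.sum_sub_distrib]
  simp_rw [← Finset.sum_sub_distrib]
  set f : ℕ → ℕ → ℝ := fun v v' => w v * L v * (w' v' * K v') - w v * K v * (w' v' * L v')
  have hsymm : 0 ≤ ∑ v ∈ Finset.range (M + 1), ∑ v' ∈ Finset.range (M + 1), (f v v' + f v' v) := by
    have key : ∀ v v', v ≤ v' → v' ≤ M → 0 ≤ f v v' + f v' v := fun v v' h h' => by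
      have := mul_nonneg (sub_nonneg.2 (hw v v' h h')) (sub_nonneg.2 (hK v v' h h'))
      simp only [f]
      linarith
    refine Finset.sum_nonneg fun v hv => Finset.sum_nonneg fun v' hv' => ?_
    rw [Finset.mem_range] at hv hv'
    rcases le_total v v' with h | h
    · exact key v v' h (by omega)
    · rw [add_comm]
      exact key v' v h (by omega)
  simp_rw [Finset.sum_add_distrib] at hsymm
  rw [Finset.sum_comm (f := fun v v' => f v' v)] at hsymm
  linarith

/-- The growth factor `(M - v) s / ((v + 1) l)` is a lower bound for `K` and an upper bound for `L`,
so `K / L` increases step by step. -/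
lemma ratio_mono {M : ℕ} {s l : ℝ} (hs : 0 < s) (hl : 0 ≤ l) {K L : ℕ → ℝ}
    (hK0 : ∀ v, 0 ≤ K v) (hL0 : ∀ v, 0 ≤ L v)
    (hK : ∀ v < M, ((M : ℝ) - v) * s * K v ≤ (v + 1) * l * K (v + 1))
    (hL : ∀ v < M, (v + 1) * l * L (v + 1) ≤ ((M : ℝ) - v) * s * L v)
    {v v' : ℕ} (h : v ≤ v') (h' : v' ≤ M) : K v * L v' ≤ K v' * L v := by
  have hpos : ∀ v < M, 0 < ((M : ℝ) - v) * s := fun v hv =>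
    mul_pos (sub_pos.2 (by exact_mod_cast hv)) hs
  -- The case `l = 0`, which occurs at level `b = lam`, forces `K v = 0` for `v < M`.
  rcases hl.eq_or_lt with rfl | hl
  · rcases h.eq_or_lt with rfl | hlt
    · exact le_rfl
    · have h1 := hK v (by omega)
      have h2 : K v = 0 := by
        rw [mul_zero, zero_mul] at h1
        exact le_antisymm (nonpos_of_mul_nonpos_right h1 (hpos v (by omega))) (hK0 v)
      rw [h2, zero_mul]
      exact mul_nonneg (hK0 _) (hL0 _)
  · induction v', h using Nat.le_induction with
    | base => exact le_rfl
    | succ x hx ih =>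
      have hxM : x < M := by omega
      have e1 := mul_le_mul_of_nonneg_left (hL x hxM) (hK0 v)
      have e2 := mul_le_mul_of_nonneg_left (ih (by omega)) (hpos x hxM).le
      have e3 := mul_le_mul_of_nonneg_right (hK x hxM) (hL0 v)
      have hc : 0 < ((x : ℝ) + 1) * l := by positivity
      refine le_of_mul_le_mul_left ?_ hc
      linarith

/-- Double counting: a set of size `v + 1` arises once for each choice of the element inserted last.
-/
lemma sum_powersetCard_insert {ι : Type*} [DecidableEq ι] (N : Finset ι) (v : ℕ)
    (f : Finset ι → ℝ) :
    ∑ S ∈ N.powersetCard v, ∑ i ∈ N \ S, f (insert i S)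
      = (v + 1) * ∑ S ∈ N.powersetCard (v + 1), f S := by
  have h : ((v : ℝ) + 1) * ∑ S ∈ N.powersetCard (v + 1), f S
      = ∑ S ∈ N.powersetCard (v + 1), ∑ _i ∈ S, f S := by
    rw [Finset.mul_sum]
    refine Finset.sum_congr rfl fun S hS => ?_
    rw [Finset.sum_const, (Finset.mem_powersetCard.1 hS).2, nsmul_eq_mul]
    push_cast
    ring
  rw [h, Finset.sum_sigma', Finset.sum_sigma']
  refine Finset.sum_bij' (fun x _ => ⟨insert x.2 x.1, x.2⟩) (fun x _ => ⟨x.1.erase x.2, x.2⟩)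
    ?_ ?_ ?_ ?_ ?_
  · rintro ⟨S, i⟩ hx
    simp only [Finset.mem_sigma, Finset.mem_powersetCard, Finset.mem_sdiff] at hx ⊢
    refine ⟨⟨Finset.insert_subset hx.2.1 hx.1.1, ?_⟩, Finset.mem_insert_self _ _⟩
    rw [Finset.card_insert_of_notMem hx.2.2, hx.1.2]
  · rintro ⟨S, i⟩ hx
    simp only [Finset.mem_sigma, Finset.mem_powersetCard, Finset.mem_sdiff] at hx ⊢
    refine ⟨⟨(Finset.erase_subset _ _).trans hx.1.1, ?_⟩, hx.1.1 hx.2, Finset.notMem_erase _ _⟩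
    rw [Finset.card_erase_of_mem hx.2, hx.1.2, Nat.add_sub_cancel]
  · rintro ⟨S, i⟩ hx
    simp only [Finset.mem_sigma, Finset.mem_sdiff] at hx
    simp [Finset.erase_insert hx.2.2]
  · rintro ⟨S, i⟩ hx
    simp only [Finset.mem_sigma] at hx
    simp [Finset.insert_erase hx.2]
  · rintro ⟨S, i⟩ _
    rfl

lemma sum_powerset_eq_sum_range {ι : Type*} (N : Finset ι) (g : ℕ → ℝ) (f : Finset ι → ℝ) :
    ∑ S ∈ N.powerset, g S.card * f S
      = ∑ v ∈ Finset.range (N.card + 1), g v * ∑ S ∈ N.powersetCard v, f S := by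
  rw [Finset.sum_powerset]
  refine Finset.sum_congr rfl fun v _ => ?_
  rw [Finset.mul_sum]
  exact Finset.sum_congr rfl fun S hS => by rw [(Finset.mem_powersetCard.1 hS).2]

/-- By `(i + 1) * C(n, i + 1) = (n - i) * C(n, i)`, the term of size `i + 1` is `x` times the
binomial probability of `i`. Only `i = n` is missing from the total mass. -/
lemma sum_powerset_ratio_le {ι : Type*} (N : Finset ι) {x : ℝ} (h0 : 0 ≤ x) (h1 : x < 1) :
    ∑ S ∈ N.powerset, x ^ S.card * (1 - x) ^ (N.card - S.card)
      * ((S.card : ℝ) * ((1 - x) / ((N.card : ℝ) - S.card + 1))) ≤ x := by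
  have h1' : 0 < 1 - x := by linarith
  rw [Finset.sum_powerset_apply_card (fun m => x ^ m * (1 - x) ^ (N.card - m)
    * ((m : ℝ) * ((1 - x) / ((N.card : ℝ) - m + 1)))), Finset.sum_range_succ']
  generalize N.card = n
  simp only [nsmul_eq_mul, Nat.cast_zero, zero_mul, mul_zero, add_zero]
  have hb := add_pow x (1 - x) n
  rw [add_sub_cancel, one_pow] at hb
  calc _ = ∑ i ∈ Finset.range n, x * (x ^ i * (1 - x) ^ (n - i) * n.choose i) := by
        refine Finset.sum_congr rfl fun i hi => ?_
        have hi' : i < n := Finset.mem_range.1 hi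
        have hlt : (i : ℝ) < n := by exact_mod_cast hi'
        have hc : (n.choose (i + 1) : ℝ) * (i + 1) = n.choose i * ((n : ℝ) - i) := by
          rw [← Nat.cast_sub hi'.le]
          exact_mod_cast Nat.choose_succ_right_eq n i
        have hp : n - i = (n - (i + 1)) + 1 := by omega
        have hne : (n : ℝ) - i ≠ 0 := by linarith
        have hd : (n : ℝ) - ((i + 1 : ℕ) : ℝ) + 1 = n - i := by
          push_cast
          ring
        rw [hp, hd, eq_div_of_mul_eq hne hc.symm]
        push_cast
        ring
    _ ≤ ∑ i ∈ Finset.range (n + 1), x * (x ^ i * (1 - x) ^ (n - i) * n.choose i) := by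
        rw [Finset.sum_range_succ]
        have : 0 ≤ x * (x ^ n * (1 - x) ^ (n - n) * n.choose n) := by positivity
        linarith
    _ = x := by rw [← Finset.mul_sum, ← hb, mul_one]

/-! ### The procedure in terms of counts below thresholds -/

/-- The indices in `N` whose coordinate is at most `t`. -/
noncomputable def lows {ι : Type*} (N : Finset ι) (t : ℝ) (x : ι → ℝ) : Finset ι :=
  N.filter fun i => x i ≤ t

lemma mem_lows {ι : Type*} {N : Finset ι} {t : ℝ} {x : ι → ℝ} {i : ι} :
    i ∈ lows N t x ↔ i ∈ N ∧ x i ≤ t := Finset.mem_filter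

lemma lows_mono {ι : Type*} (N : Finset ι) {t t' : ℝ} (h : t ≤ t') (x : ι → ℝ) :
    lows N t x ⊆ lows N t' x := fun _ hi =>
  mem_lows.2 ⟨(mem_lows.1 hi).1, (mem_lows.1 hi).2.trans h⟩

variable {n : ℕ}

lemma orderStat_le_iff (x : Fin n → ℝ) (i : Fin n) (t : ℝ) :
    orderStat x i ≤ t ↔ (i : ℕ) < (lows Finset.univ t x).card := by
  have hcard : (lows Finset.univ t x).card
      = (Finset.univ.filter fun i => (x ∘ Tuple.sort x) i ≤ t).card := by
    symm
    refine Finset.card_equiv (Tuple.sort x) fun i => ?_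
    simp [mem_lows]
  rw [hcard, Tuple.lt_card_le_iff_apply_le_of_monotone (Tuple.monotone_sort x)]
  rfl

lemma card_lows_univ_le (t : ℝ) (x : Fin n → ℝ) : (lows Finset.univ t x).card ≤ n :=
  (Finset.card_le_univ _).trans (Fintype.card_fin n).le

lemma firstStage_eq (lam : ℝ) (x : Fin n → ℝ) :
    firstStage lam x = (lows Finset.univ lam x).card := by
  refine le_antisymm (Finset.sup_le fun i hi => ?_) ?_
  · exact (orderStat_le_iff x i lam).1 (Finset.mem_filter.1 hi).2
  · rcases Nat.eq_zero_or_pos (lows Finset.univ lam x).card with h | h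
    · omega
    · have hn := card_lows_univ_le lam x
      have := Finset.le_sup (s := Finset.univ.filter fun i : Fin n => orderStat x i ≤ lam)
        (f := fun i : Fin n => (i : ℕ) + 1)
        (b := ⟨(lows Finset.univ lam x).card - 1, by omega⟩)
        (Finset.mem_filter.2 ⟨Finset.mem_univ _, (orderStat_le_iff x _ lam).2
          (by change (lows Finset.univ lam x).card - 1 < _; omega)⟩)
      dsimp only at this
      rw [firstStage]
      omega

lemma secondStage_spec (k : ℕ) (α lam : ℝ) (x : Fin n → ℝ) (h : 1 ≤ secondStage k α lam x) :
    secondStage k α lam x ≤ firstStage lam x ∧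
      secondStage k α lam x
        ≤ (lows Finset.univ (crit k n α lam (secondStage k α lam x) (firstStage lam x)) x).card := by
  set F := Finset.univ.filter fun i : Fin n => (i : ℕ) + 1 ≤ firstStage lam x ∧
      orderStat x i ≤ crit k n α lam ((i : ℕ) + 1) (firstStage lam x) with hF
  have hs : secondStage k α lam x = F.sup fun i => (i : ℕ) + 1 := rfl
  have hne : F.Nonempty := by
    rw [Finset.nonempty_iff_ne_empty]
    intro h0
    rw [hs, h0] at h
    simp at h
  obtain ⟨i, hi, he⟩ := Finset.exists_mem_eq_sup F hne fun i : Fin n => (i : ℕ) + 1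
  rw [hs, he]
  obtain ⟨h1, h2⟩ := (Finset.mem_filter.1 hi).2
  exact ⟨h1, (orderStat_le_iff x i _).1 h2⟩

lemma le_secondStage (k : ℕ) (α lam : ℝ) (x : Fin n → ℝ) {s : ℕ} (h1 : 1 ≤ s)
    (hj : s ≤ firstStage lam x)
    (hs : s ≤ (lows Finset.univ (crit k n α lam s (firstStage lam x)) x).card) :
    s ≤ secondStage k α lam x := by
  have hn : s ≤ n := hs.trans (card_lows_univ_le _ x)
  have hs1 : s - 1 + 1 = s := by omega
  have := Finset.le_sup (s := Finset.univ.filter fun i : Fin n =>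
      (i : ℕ) + 1 ≤ firstStage lam x ∧
        orderStat x i ≤ crit k n α lam ((i : ℕ) + 1) (firstStage lam x))
    (f := fun i : Fin n => (i : ℕ) + 1) (b := ⟨s - 1, by omega⟩)
    (Finset.mem_filter.2 ⟨Finset.mem_univ _, by
      simp only [orderStat_le_iff, hs1]
      exact ⟨hj, by omega⟩⟩)
  simp only [hs1] at this
  exact this

lemma card_rejected (k : ℕ) (α lam : ℝ) (x : Fin n → ℝ) (hle : secondStage k α lam x ≤ n) :
    (rejected k α lam x).card = secondStage k α lam x := by
  have hinj : Function.Injective (ranked x) := (Tuple.sort x).injective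
  rw [rejected, Finset.card_image_of_injective _ hinj]
  have := Fin.card_filter_val_lt (n := n) (m := secondStage k α lam x)
  rw [this, min_eq_right hle]

/-- By maximality no further coordinate lies below the last critical value, so ties do not matter:
an extra one would make the next rank qualify, or, at the last rank of the first stage, put too many
coordinates below `lam`. -/
lemma rejected_eq {k : ℕ} {α lam : ℝ} {x : Fin n → ℝ} (h : 1 ≤ secondStage k α lam x)
    (hmono : crit k n α lam (secondStage k α lam x) (firstStage lam x)
      ≤ crit k n α lam (secondStage k α lam x + 1) (firstStage lam x))
    (hlam : crit k n α lam (secondStage k α lam x) (firstStage lam x) ≤ lam) :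
    rejected k α lam x
      = lows Finset.univ (crit k n α lam (secondStage k α lam x) (firstStage lam x)) x := by
  obtain ⟨hj, hc⟩ := secondStage_spec k α lam x h
  refine Finset.eq_of_subset_of_card_le ?_ ?_
  · intro i hi
    obtain ⟨l, hl, rfl⟩ := Finset.mem_image.1 hi
    refine mem_lows.2 ⟨Finset.mem_univ _, ?_⟩
    exact (orderStat_le_iff x l _).2 ((Finset.mem_filter.1 hl).2.trans_le hc)
  · rw [card_rejected k α lam x (hc.trans (card_lows_univ_le _ x))]
    by_contra! hcon
    rcases hj.eq_or_lt with he | hlt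
    · have := Finset.card_le_card (lows_mono Finset.univ hlam x)
      rw [← firstStage_eq lam x] at this
      omega
    · have := le_secondStage k α lam x (s := secondStage k α lam x + 1) (by omega) hlt
        (hcon.trans_le (Finset.card_le_card (lows_mono Finset.univ hmono x)))
      omega

/-- The vectors for which `W` is the set of coordinates at most `lam`, and the step-up procedure
with critical values `c` rejects at least `r` hypotheses (for `r ≥ 1`). -/
def upperEvent {ι : Type*} [Fintype ι] (lam : ℝ) (c : ℕ → ℝ) (W : Finset ι) (r : ℕ) :
    Set (ι → ℝ) :=
  {x | lows Finset.univ lam x = W ∧ ∃ s ∈ Finset.Icc r W.card, s ≤ (lows Finset.univ (c s) x).card}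

lemma mem_upperEvent_iff {k : ℕ} {α lam : ℝ} {x : Fin n → ℝ} {W : Finset (Fin n)}
    (hW : lows Finset.univ lam x = W) {r : ℕ} (hr : 1 ≤ r) :
    x ∈ upperEvent lam (fun s => crit k n α lam s W.card) W r ↔ r ≤ secondStage k α lam x := by
  have hj : firstStage lam x = W.card := by rw [firstStage_eq, hW]
  constructor
  · rintro ⟨-, s, hs, hc⟩
    rw [Finset.mem_Icc] at hs
    refine hs.1.trans (le_secondStage k α lam x (hr.trans hs.1) (by omega) ?_)
    rwa [hj]
  · intro h
    obtain ⟨h1, h2⟩ := secondStage_spec k α lam x (hr.trans h)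
    rw [hj] at h1 h2
    exact ⟨hW, _, Finset.mem_Icc.2 ⟨h, h1⟩, h2⟩

open Classical in
-- At most one term survives: `W` from the first stage, `r` the number of rejections, `T` the
-- rejected nulls. The form as a finite sum of indicators gives integrability and reduces the mean
-- to probabilities.
lemma kFDP_rejected_eq {k : ℕ} {α lam : ℝ} (nulls : Finset (Fin n))
    (hmono : ∀ j ≤ n, ∀ r, 1 ≤ r → crit k n α lam r j ≤ crit k n α lam (r + 1) j)
    (hlam : ∀ j r, crit k n α lam r j ≤ lam) (x : Fin n → ℝ) :
    kFDP k nulls (rejected k α lam x) = ∑ W : Finset (Fin n), ∑ r ∈ Finset.Icc 1 W.card,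
      ∑ T ∈ (W ∩ nulls).powerset,
        ((upperEvent lam (fun s => crit k n α lam s W.card) W r
          \ upperEvent lam (fun s => crit k n α lam s W.card) W (r + 1)) ∩
          {x | lows (W ∩ nulls) (crit k n α lam r W.card) x = T}).indicator
          (fun _ => wt k T.card / r) x := by
  set W := lows Finset.univ lam x with hW
  have hj : firstStage lam x = W.card := by rw [firstStage_eq]
  have hn : W.card ≤ n := card_lows_univ_le _ _
  set R := secondStage k α lam x with hR
  rw [Finset.sum_eq_single W]
  rotate_left
  · intro W' _ hne
    refine Finset.sum_eq_zero fun r _ => Finset.sum_eq_zero fun T _ => ?_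
    refine Set.indicator_of_notMem (fun h => hne ?_) _
    exact h.1.1.1.symm
  · simp
  have hmem : ∀ r, 1 ≤ r → (x ∈ upperEvent lam (fun s => crit k n α lam s W.card) W r ↔ r ≤ R) :=
    fun r hr => mem_upperEvent_iff hW.symm hr
  rcases Nat.eq_zero_or_pos R with h0 | hpos
  · rw [Finset.sum_eq_zero]
    · have : rejected k α lam x = ∅ := by
        rw [rejected, ← hR, h0]
        simp
      rw [this, kFDP]
      simp
    · intro r hr
      rw [Finset.mem_Icc] at hr
      refine Finset.sum_eq_zero fun T _ => Set.indicator_of_notMem (fun h => ?_) _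
      have := (hmem r hr.1).1 h.1.1
      omega
  · have hRj : R ≤ W.card := hj ▸ (secondStage_spec k α lam x hpos).1
    rw [Finset.sum_eq_single_of_mem R (Finset.mem_Icc.2 ⟨hpos, hRj⟩)]
    · have hrej : rejected k α lam x = lows Finset.univ (crit k n α lam R W.card) x := by
        rw [rejected_eq hpos (hmono _ (hj ▸ hn) _ hpos) (hlam _ _), hj]
      have hlow : lows Finset.univ (crit k n α lam R W.card) x ∩ nulls
          = lows (W ∩ nulls) (crit k n α lam R W.card) x := by
        ext i
        simp only [Finset.mem_inter, mem_lows, hW, Finset.mem_univ, true_and]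
        have := hlam W.card R
        constructor
        · rintro ⟨h1, h2⟩
          exact ⟨⟨h1.trans this, h2⟩, h1⟩
        · rintro ⟨⟨_, h2⟩, h1⟩
          exact ⟨h1, h2⟩
      rw [Finset.sum_eq_single_of_mem (lows (W ∩ nulls) (crit k n α lam R W.card) x)
        (Finset.mem_powerset.2 (Finset.filter_subset _ _))]
      · rw [Set.indicator_of_mem]
        · rw [kFDP, card_rejected k α lam x (hRj.trans hn), hrej, hlow, wt, ← hR,
            max_eq_left (by exact_mod_cast hpos)]
        · refine ⟨⟨(hmem R hpos).2 le_rfl, fun h => ?_⟩, rfl⟩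
          have := (hmem (R + 1) (by omega)).1 h
          omega
      · intro T _ hne
        exact Set.indicator_of_notMem (fun h => hne h.2.symm) _
    · intro r hr hne
      rw [Finset.mem_Icc] at hr
      refine Finset.sum_eq_zero fun T _ => Set.indicator_of_notMem (fun h => hne ?_) _
      have h1 := (hmem r hr.1).1 h.1.1
      have h2 := mt (hmem (r + 1) (by omega)).2 h.1.2
      omega

/-! ### Events stable under lowering coordinates -/

section Coordinates

variable {ι : Type*}

/-- Lowering coordinates in `N` to a value at most `b` does not lead out of `A`. -/
def IsUp (N : Finset ι) (b : ℝ) (A : Set (ι → ℝ)) : Prop :=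
  ∀ x y : ι → ℝ, (∀ i, x i = y i ∨ (i ∈ N ∧ y i ≤ b)) → x ∈ A → y ∈ A

/-- The integral over `A` of `wt k` of the number of coordinates in `N` that are at most `a`. -/
noncomputable def wtIntegral (P : Measure (ι → ℝ)) (k : ℕ) (N : Finset ι) (A : Set (ι → ℝ))
    (a : ℝ) : ℝ :=
  ∑ T ∈ N.powerset, wt k T.card * P.real (A ∩ {x | lows N a x = T})

lemma wtIntegral_nonneg (P : Measure (ι → ℝ)) (k : ℕ) (N : Finset ι) (A : Set (ι → ℝ)) (a : ℝ) : 0 ≤ wtIntegral P k N A a :=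
  Finset.sum_nonneg fun _ _ => mul_nonneg (wt_nonneg _ _) measureReal_nonneg

lemma wtIntegral_mono (P : Measure (ι → ℝ)) [IsFiniteMeasure P] (k : ℕ) (N : Finset ι) {A A' : Set (ι → ℝ)} (h : A ⊆ A') (a : ℝ) :
    wtIntegral P k N A a ≤ wtIntegral P k N A' a :=
  Finset.sum_le_sum fun _ _ => mul_le_mul_of_nonneg_left
    (measureReal_mono (Set.inter_subset_inter_left _ h)) (wt_nonneg _ _)

/-- The coordinates in `N` have the distribution function of the uniform law on `(0, 1)`, up to
`lam`. -/
def UniformUpTo (P : Measure (ι → ℝ)) (N : Finset ι) (lam : ℝ) : Prop :=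
  ∀ i ∈ N, ∀ t, 0 ≤ t → t ≤ lam → P.real {x | x i ≤ t} = t

lemma UniformUpTo.measureReal_Ioc {P : Measure (ι → ℝ)} [IsFiniteMeasure P]
    {N : Finset ι} {lam : ℝ} (hU : UniformUpTo P N lam) {i : ι} (hi : i ∈ N) {a b : ℝ}
    (ha : 0 ≤ a) (hab : a ≤ b) (hb : b ≤ lam) : P.real {x | x i ∈ Set.Ioc a b} = b - a := by
  have : {x : ι → ℝ | x i ∈ Set.Ioc a b} = {x | x i ≤ b} \ {x | x i ≤ a} := by
    ext x
    simp [and_comm]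
  have hsub : {x : ι → ℝ | x i ≤ a} ⊆ {x | x i ≤ b} := fun x (hx : x i ≤ a) => hx.trans hab
  rw [this, measureReal_sdiff hsub
    (measurableSet_le (measurable_pi_apply i) measurable_const), hU i hi b (ha.trans hab) hb,
    hU i hi a ha (hab.trans hb)]

variable [DecidableEq ι]

/-- Overwriting the coordinates in `S` by `b`. -/
def overwrite (S : Finset ι) (b : ℝ) (x : ι → ℝ) : ι → ℝ := fun i => if i ∈ S then b else x i

lemma measurable_overwrite (S : Finset ι) (b : ℝ) : Measurable (overwrite S b) := by
  refine measurable_pi_lambda _ fun i => ?_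
  by_cases h : i ∈ S
  · simpa only [overwrite, h, if_true] using measurable_const
  · simpa only [overwrite, h, if_false] using measurable_pi_apply _

lemma overwrite_congr {S : Finset ι} {b : ℝ} {x y : ι → ℝ} (h : ∀ i ∉ S, x i = y i) :
    overwrite S b x = overwrite S b y := by
  funext i
  by_cases hi : i ∈ S
  · simp [overwrite, hi]
  · simp [overwrite, hi, h i hi]

/-- `IsUp` lets coordinates below `b` move freely there. Given that those in `S` are below `b`,
their exact values are therefore irrelevant, and independence applies. -/
lemma inter_lows_eq_eq_box {N : Finset ι} {b : ℝ} {A : Set (ι → ℝ)} (hup : IsUp N b A) {S : Finset ι}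
    (hS : S ⊆ N) :
    A ∩ {x | lows N b x = S} = {x | ∀ i ∈ S, x i ∈ Set.Iic b} ∩
      overwrite S b ⁻¹' (A ∩ {x | lows N b x = S}) := by
  ext x
  have hlow : (∀ i ∈ S, x i ≤ b) → lows N b (overwrite S b x) = lows N b x := fun h => by
    ext i
    rw [mem_lows, mem_lows]
    by_cases hi : i ∈ S
    · simp [overwrite, hi, h i hi]
    · simp [overwrite, hi]
  constructor
  · rintro ⟨hA, hx⟩
    have hle : ∀ i ∈ S, x i ≤ b := fun i hi => (mem_lows.1 (hx.symm ▸ hi : i ∈ lows N b x)).2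
    refine ⟨hle, hup x _ (fun i => ?_) hA, (hlow hle).trans hx⟩
    by_cases hi : i ∈ S
    · exact Or.inr ⟨hS hi, by simp [overwrite, hi]⟩
    · exact Or.inl (by simp [overwrite, hi])
  · rintro ⟨hle, hA, hx⟩
    refine ⟨hup _ x (fun i => ?_) hA, (hlow hle).symm.trans hx⟩
    by_cases hi : i ∈ S
    · exact Or.inr ⟨hS hi, hle i hi⟩
    · exact Or.inl (by simp [overwrite, hi])

end Coordinates

/-! ### Independence, thinning and exchange -/

section Measure

variable {ι : Type*} [Fintype ι]

lemma measurableSet_lows_eq (N : Finset ι) (t : ℝ) (S : Finset ι) :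
    MeasurableSet {x : ι → ℝ | lows N t x = S} := by
  have : {x : ι → ℝ | lows N t x = S} = ⋂ i, {x | i ∈ lows N t x ↔ i ∈ S} := by
    ext x
    simp [Finset.ext_iff]
  rw [this]
  refine MeasurableSet.iInter fun i => ?_
  simp only [mem_lows]
  have hm : MeasurableSet {x : ι → ℝ | x i ≤ t} :=
    measurableSet_le (measurable_pi_apply i) measurable_const
  exact ((MeasurableSet.const (i ∈ N)).inter hm).iff (MeasurableSet.const (i ∈ S))

lemma measurableSet_upperEvent (lam : ℝ) (c : ℕ → ℝ) (W : Finset ι) (r : ℕ) :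
    MeasurableSet (upperEvent lam c W r) := by
  have : upperEvent lam c W r = {x | lows Finset.univ lam x = W} ∩
      ⋃ s ∈ Finset.Icc r W.card, ⋃ S : Finset ι, ⋃ _ : s ≤ S.card,
        {x | lows Finset.univ (c s) x = S} := by
    ext x
    simp [upperEvent]
  rw [this]
  refine (measurableSet_lows_eq _ _ _).inter (Finset.measurableSet_biUnion _ fun s _ => ?_)
  exact MeasurableSet.iUnion fun S => MeasurableSet.iUnion fun _ => measurableSet_lows_eq _ _ _

variable {P : Measure (ι → ℝ)}

/-- Under an independent law, a box in the coordinates of `S` is independent of an event that does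
not depend on these coordinates. -/
lemma measureReal_box_inter [DecidableEq ι] (hP : iIndepFun (fun i (x : ι → ℝ) => x i) P) (S : Finset ι)
    {Z : ι → Set ℝ} (hZ : ∀ i, MeasurableSet (Z i)) {D : Set (ι → ℝ)} (hD : MeasurableSet D)
    (hDS : ∀ x y : ι → ℝ, (∀ i ∉ S, x i = y i) → x ∈ D → y ∈ D) :
    P.real ({x | ∀ i ∈ S, x i ∈ Z i} ∩ D) = (∏ i ∈ S, P.real {x | x i ∈ Z i}) * P.real D := by
  have hind := hP.indepFun_finset S Sᶜ disjoint_compl_right fun i => measurable_pi_apply i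
  -- The padding value `0` is immaterial, since `D` ignores the coordinates in `S`.
  set ext : ((Sᶜ : Finset ι) → ℝ) → ι → ℝ := fun z i => if h : i ∈ Sᶜ then z ⟨i, h⟩ else 0
  have hext : Measurable ext := by
    refine measurable_pi_lambda _ fun i => ?_
    by_cases h : i ∈ Sᶜ
    · simpa only [ext, h, dite_true] using measurable_pi_apply _
    · simpa only [ext, h, dite_false] using measurable_const
  have e1 : {x : ι → ℝ | ∀ i ∈ S, x i ∈ Z i}
      = (fun (x : ι → ℝ) (i : S) => x i) ⁻¹' {z | ∀ i : S, z i ∈ Z i} := by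
    ext x
    simp
  have e2 : D = (fun (x : ι → ℝ) (i : (Sᶜ : Finset ι)) => x i) ⁻¹' (ext ⁻¹' D) := by
    ext x
    have : ∀ i ∉ S, x i = ext (fun i : (Sᶜ : Finset ι) => x i) i := fun i hi => by simp [ext, hi]
    exact ⟨hDS _ _ this, hDS _ _ fun i hi => (this i hi).symm⟩
  have hm1 : MeasurableSet {z : S → ℝ | ∀ i : S, z i ∈ Z i} := by
    have : {z : S → ℝ | ∀ i : S, z i ∈ Z i} = ⋂ i : S, (fun z : S → ℝ => z i) ⁻¹' Z i := by
      ext z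
      simp
    rw [this]
    exact MeasurableSet.iInter fun i => measurable_pi_apply i (hZ i)
  have h := hind.measure_inter_preimage_eq_mul _ _ hm1 (hext hD)
  rw [← e1, ← e2] at h
  have h2 := hP.measure_inter_preimage_eq_mul S (sets := Z) fun i _ => hZ i
  have e3 : ⋂ i ∈ S, (fun x : ι → ℝ => x i) ⁻¹' Z i = {x | ∀ i ∈ S, x i ∈ Z i} := by
    ext x
    simp
  rw [e3] at h2
  rw [measureReal_def, h, h2, ENNReal.toReal_mul, ENNReal.toReal_prod]
  rfl

lemma isUp_lows_eq {lam b : ℝ} (hb : b ≤ lam) {N W : Finset ι} (hN : N ⊆ W) :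
    IsUp N b {x : ι → ℝ | lows Finset.univ lam x = W} := by
  intro x y hxy hx
  simp only [Set.mem_ofPred_eq, Finset.ext_iff, mem_lows, Finset.mem_univ, true_and] at hx ⊢
  intro i
  rcases hxy i with h | ⟨h1, h2⟩
  · rw [← h, hx]
  · exact ⟨fun _ => hN h1, fun _ => h2.trans hb⟩

/-- Values at most `b` lie below every threshold `c s` in use, so the counts cannot drop; `W` is
unchanged because `N ⊆ W` and `b ≤ lam`. -/
lemma isUp_upperEvent {lam b : ℝ} (hb : b ≤ lam) {N W : Finset ι} (hN : N ⊆ W) {c : ℕ → ℝ}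
    {r : ℕ} (hc : ∀ s, r ≤ s → b ≤ c s) : IsUp N b (upperEvent lam c W r) := by
  rintro x y hxy ⟨hx, s, hs, hcard⟩
  refine ⟨isUp_lows_eq hb hN x y hxy hx, s, hs, hcard.trans (Finset.card_le_card fun i hi => ?_)⟩
  rw [mem_lows] at hi ⊢
  rcases hxy i with h | ⟨_, h2⟩
  · rwa [← h]
  · exact ⟨hi.1, h2.trans (hc s (Finset.mem_Icc.1 hs).1)⟩

variable {N : Finset ι} {lam : ℝ}

lemma inter_lows_eq_self {W : Finset ι} (hN : N ⊆ W) :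
    {x : ι → ℝ | lows Finset.univ lam x = W} ∩ {x | lows N lam x = N}
      = {x | lows Finset.univ lam x = W} := by
  refine Set.inter_eq_left.2 fun x hx => ?_
  have hx' : lows Finset.univ lam x = W := hx
  refine Finset.filter_true_of_mem fun i hi => ?_
  exact (mem_lows.1 (hx'.symm ▸ hN hi : i ∈ lows Finset.univ lam x)).2

variable [IsProbabilityMeasure P]

lemma sum_measureReal_inter_lows {A : Set (ι → ℝ)} (hA : MeasurableSet A) (b : ℝ) :
    ∑ S ∈ N.powerset, P.real (A ∩ {x | lows N b x = S}) = P.real A := by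
  have hu : A = ⋃ S ∈ N.powerset, A ∩ {x | lows N b x = S} := by
    ext x
    simp only [Set.mem_iUnion, Set.mem_inter_iff, Set.mem_ofPred_eq]
    exact ⟨fun h => ⟨_, Finset.mem_powerset.2 (Finset.filter_subset _ _), h, rfl⟩,
      fun ⟨_, _, h, _⟩ => h⟩
  conv_rhs => rw [hu]
  rw [measureReal_biUnion_finset]
  · intro S _ T _ hne
    refine Set.disjoint_left.2 fun x hx hx' => hne ?_
    exact hx.2.symm.trans hx'.2
  · exact fun S _ => hA.inter (measurableSet_lows_eq _ _ _)

variable [DecidableEq ι]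

/-- Given the set of coordinates at most `b`, those at most `a` are chosen independently with
probability `a / b` each. -/
lemma measureReal_thinning (hP : iIndepFun (fun i (x : ι → ℝ) => x i) P)
    (hU : UniformUpTo P N lam) {a b : ℝ} (ha : 0 ≤ a) (hab : a ≤ b) (hb0 : 0 < b) (hb : b ≤ lam)
    {A : Set (ι → ℝ)} (hA : MeasurableSet A) (hup : IsUp N b A) {S T : Finset ι} (hS : S ⊆ N)
    (hT : T ⊆ S) :
    P.real (A ∩ {x | lows N b x = S} ∩ {x | lows N a x = T})
      = (a / b) ^ T.card * (1 - a / b) ^ (S.card - T.card)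
        * P.real (A ∩ {x | lows N b x = S}) := by
  set D := overwrite S b ⁻¹' (A ∩ {x | lows N b x = S}) with hD
  have hDm : MeasurableSet D :=
    measurable_overwrite S b (hA.inter (measurableSet_lows_eq _ _ _))
  have hDS : ∀ x y : ι → ℝ, (∀ i ∉ S, x i = y i) → x ∈ D → y ∈ D := fun x y h hx => by
    simpa only [hD, Set.mem_preimage, overwrite_congr h] using hx
  have h1 : P.real (A ∩ {x | lows N b x = S}) = b ^ S.card * P.real D := by
    rw [inter_lows_eq_eq_box hup hS, ← hD,
      measureReal_box_inter hP S (fun _ => measurableSet_Iic) hDm hDS]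
    congr 1
    rw [← Finset.prod_const]
    exact Finset.prod_congr rfl fun i hi => hU i (hS hi) b hb0.le hb
  -- Prescribing `T` only refines the box: below `a` on `T`, in `(a, b]` on the rest of `S`.
  have e : A ∩ {x | lows N b x = S} ∩ {x | lows N a x = T}
      = {x | ∀ i ∈ S, x i ∈ if i ∈ T then Set.Iic a else Set.Ioc a b} ∩ D := by
    rw [inter_lows_eq_eq_box hup hS, ← hD]
    ext x
    constructor
    · rintro ⟨⟨hle, hx⟩, hl⟩
      refine ⟨fun i hi => ?_, hx⟩
      have hl' : lows N a x = T := hl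
      split_ifs with h
      · exact (mem_lows.1 (hl'.symm ▸ h : i ∈ lows N a x)).2
      · refine ⟨?_, hle i hi⟩
        by_contra! hcon
        exact h (hl' ▸ mem_lows.2 ⟨hS hi, hcon⟩)
    · rintro ⟨hbox, hx⟩
      have hle : ∀ i ∈ S, x i ∈ Set.Iic b := fun i hi => by
        have := hbox i hi
        split_ifs at this with h
        · exact le_trans this hab
        · exact this.2
      refine ⟨⟨hle, hx⟩, ?_⟩
      have hxS : x ∈ A ∩ {x | lows N b x = S} := by
        rw [inter_lows_eq_eq_box hup hS]
        exact ⟨hle, hx⟩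
      have hlowS : lows N b x = S := hxS.2
      change lows N a x = T
      ext i
      rw [mem_lows]
      constructor
      · rintro ⟨hi, hia⟩
        have hiS : i ∈ S := hlowS ▸ mem_lows.2 ⟨hi, hia.trans hab⟩
        have := hbox i hiS
        split_ifs at this with h
        · exact h
        · exact absurd this.1 (not_lt.2 hia)
      · intro hi
        have := hbox i (hT hi)
        rw [if_pos hi] at this
        exact ⟨hS (hT hi), this⟩
  have h2 : P.real (A ∩ {x | lows N b x = S} ∩ {x | lows N a x = T})
      = a ^ T.card * (b - a) ^ (S.card - T.card) * P.real D := by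
    rw [e, measureReal_box_inter hP S (fun i => by split_ifs <;> measurability) hDm hDS]
    congr 1
    have : ∀ i ∈ S, P.real {x : ι → ℝ | x i ∈ if i ∈ T then Set.Iic a else Set.Ioc a b}
        = if i ∈ T then a else b - a := fun i hi => by
      split_ifs with h
      · exact hU i (hS hi) a ha (hab.trans hb)
      · exact hU.measureReal_Ioc (hS hi) ha hab hb
    rw [Finset.prod_congr rfl this, Finset.prod_ite, Finset.prod_const, Finset.prod_const,
      Finset.filter_mem_eq_inter, Finset.inter_eq_right.2 hT, Finset.filter_notMem_eq_sdiff,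
      Finset.card_sdiff_of_subset hT]
  have hc : S.card = T.card + (S.card - T.card) := by
    have := Finset.card_le_card hT
    omega
  have hpow : b ^ S.card = b ^ T.card * b ^ (S.card - T.card) := by rw [← pow_add, ← hc]
  have hbT : b ^ T.card ≠ 0 := by positivity
  have hbS : b ^ (S.card - T.card) ≠ 0 := by positivity
  rw [h2, h1, one_sub_div hb0.ne', div_pow, div_pow, hpow]
  clear_value D
  generalize S.card - T.card = m at *
  field_simp

/-- Moving one more coordinate below `b`. -/
lemma measureReal_exchange (hP : iIndepFun (fun i (x : ι → ℝ) => x i) P)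
    (hU : UniformUpTo P N lam) {b : ℝ} (hb0 : 0 < b) (hb : b ≤ lam)
    {A : Set (ι → ℝ)} (hA : MeasurableSet A) (hAlam : ∀ x ∈ A, ∀ i ∈ N, x i ≤ lam)
    (hup : IsUp N b A) {S : Finset ι} {i : ι} (hi : i ∈ N) (hiS : i ∉ S) :
    b * P.real (A ∩ {x | lows N b x = S})
      ≤ (lam - b) * P.real (A ∩ {x | lows N b x = insert i S}) := by
  set D := overwrite {i} b ⁻¹' (A ∩ {x | lows N b x = insert i S}) with hD
  have hDm : MeasurableSet D :=
    measurable_overwrite {i} b (hA.inter (measurableSet_lows_eq _ _ _))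
  have hDS : ∀ x y : ι → ℝ, (∀ j ∉ ({i} : Finset ι), x j = y j) → x ∈ D → y ∈ D :=
    fun x y h hx => by simpa only [hD, Set.mem_preimage, overwrite_congr h] using hx
  have hlow : ∀ x : ι → ℝ, lows N b (overwrite {i} b x) = insert i (lows N b x) := fun x => by
    ext j
    rw [Finset.mem_insert, mem_lows, mem_lows]
    by_cases hj : j = i
    · simp [overwrite, hj, hi]
    · simp [overwrite, hj]
  -- Here coordinate `i` lies in `(b, lam]`, and lowering it to `b` leads into the event defining
  -- `D`.
  have h1 : P.real (A ∩ {x | lows N b x = S}) ≤ (lam - b) * P.real D := by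
    calc _ ≤ P.real ({x | ∀ j ∈ ({i} : Finset ι), x j ∈ Set.Ioc b lam} ∩ D) := by
          refine measureReal_mono ?_
          rintro x ⟨hx, hl⟩
          have hl' : lows N b x = S := hl
          have hgt : b < x i := by
            by_contra! hcon
            exact hiS (hl' ▸ mem_lows.2 ⟨hi, hcon⟩)
          refine ⟨fun j hj => ?_, hup x _ (fun j => ?_) hx, ?_⟩
          · rw [Finset.mem_singleton.1 hj]
            exact ⟨hgt, hAlam x hx i hi⟩
          · by_cases hj : j = i
            · exact Or.inr (by simp [overwrite, hj, hi])
            · exact Or.inl (by simp [overwrite, hj])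
          · change lows N b (overwrite {i} b x) = insert i S
            rw [hlow, hl']
      _ = (lam - b) * P.real D := by
          rw [measureReal_box_inter hP {i} (fun _ => measurableSet_Ioc) hDm hDS,
            Finset.prod_singleton, hU.measureReal_Ioc hi hb0.le hb le_rfl]
  have h2 : b * P.real D ≤ P.real (A ∩ {x | lows N b x = insert i S}) := by
    calc _ = P.real ({x | ∀ j ∈ ({i} : Finset ι), x j ∈ Set.Iic b} ∩ D) := by
          rw [measureReal_box_inter hP {i} (fun _ => measurableSet_Iic) hDm hDS,
            Finset.prod_singleton]
          congr 1
          exact (hU i hi b hb0.le hb).symm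
      _ ≤ _ := by
          refine measureReal_mono ?_
          rintro x ⟨hx, hxA, hl⟩
          have hxi : x i ≤ b := hx i (Finset.mem_singleton_self i)
          refine ⟨hup _ x (fun j => ?_) hxA, ?_⟩
          · by_cases hj : j = i
            · exact Or.inr ⟨hj ▸ hi, hj ▸ hxi⟩
            · exact Or.inl (by simp [overwrite, hj])
          · change lows N b (overwrite {i} b x) = insert i S at hl
            rw [hlow, Finset.insert_eq_of_mem (mem_lows.2 ⟨hi, hxi⟩)] at hl
            exact hl
  calc _ ≤ b * ((lam - b) * P.real D) := mul_le_mul_of_nonneg_left h1 hb0.le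
    _ = (lam - b) * (b * P.real D) := by ring
    _ ≤ _ := mul_le_mul_of_nonneg_left h2 (sub_nonneg.2 hb)

/-- Given the set `S` of coordinates at most `b`, the number at most `a` is binomial with parameters
`#S` and `a / b`. -/
lemma wtIntegral_eq_sum_binWt {k : ℕ} (hk : 1 ≤ k)
    (hP : iIndepFun (fun i (x : ι → ℝ) => x i) P) (hU : UniformUpTo P N lam) {a b : ℝ}
    (ha : 0 ≤ a) (hab : a ≤ b) (hb0 : 0 < b) (hb : b ≤ lam)
    {A : Set (ι → ℝ)} (hA : MeasurableSet A) (hup : IsUp N b A) :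
    wtIntegral P k N A a
      = ∑ S ∈ N.powerset, binWt k S.card (a / b) * P.real (A ∩ {x | lows N b x = S}) := by
  have hsplit : ∀ T, P.real (A ∩ {x | lows N a x = T})
      = ∑ S ∈ N.powerset, P.real (A ∩ {x | lows N b x = S} ∩ {x | lows N a x = T}) := fun T => by
    rw [← sum_measureReal_inter_lows (N := N) (hA.inter (measurableSet_lows_eq N a T)) b]
    simp_rw [Set.inter_right_comm]
  simp_rw [wtIntegral, hsplit, Finset.mul_sum]
  rw [Finset.sum_comm]
  refine Finset.sum_congr rfl fun S hS => ?_
  rw [Finset.mem_powerset] at hS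
  rw [← Finset.sum_subset (Finset.powerset_mono.2 hS), ← sum_powerset_wt hk, Finset.sum_mul]
  · refine Finset.sum_congr rfl fun T hT => ?_
    rw [measureReal_thinning hP hU ha hab hb0 hb hA hup hS (Finset.mem_powerset.1 hT)]
    ring
  · intro T _ hT
    have : A ∩ {x | lows N b x = S} ∩ {x | lows N a x = T} = ∅ := by
      refine Set.eq_empty_of_forall_notMem fun x hx => hT (Finset.mem_powerset.2 ?_)
      have h1 : lows N b x = S := hx.1.2
      have h2 : lows N a x = T := hx.2
      rw [← h1, ← h2]
      exact lows_mono N hab x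
    rw [this, measureReal_empty, mul_zero]

lemma wtIntegral_lows_eq {k : ℕ} (hk : 1 ≤ k)
    (hP : iIndepFun (fun i (x : ι → ℝ) => x i) P) (hU : UniformUpTo P N lam) {a : ℝ}
    (ha : 0 ≤ a) (hal : a ≤ lam) (hlam : 0 < lam) {W : Finset ι} (hN : N ⊆ W) :
    wtIntegral P k N {x | lows Finset.univ lam x = W} a
      = binWt k N.card (a / lam) * P.real {x | lows Finset.univ lam x = W} := by
  have hm := measurableSet_lows_eq (Finset.univ : Finset ι) lam W
  rw [← sum_powerset_wt hk, Finset.sum_mul, wtIntegral]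
  refine Finset.sum_congr rfl fun T hT => ?_
  have := measureReal_thinning hP hU ha hal hlam le_rfl hm (isUp_lows_eq le_rfl hN)
    (Finset.Subset.refl N) (Finset.mem_powerset.1 hT)
  rw [inter_lows_eq_self hN] at this
  rw [this]
  ring

/-- Let `v` be the number of coordinates of `N` at most `b`. Level `b` weights `v` by `wt k v`,
level `a` by `binWt k v (a / b)`, with decreasing ratio by `wt_mul_binWt_le`. The mass of `v` on `A`
relative to that on the whole event increases with `v`, so Chebyshev's inequality applies. -/
lemma wtIntegral_mul_le {k : ℕ} (hk : 1 ≤ k)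
    (hP : iIndepFun (fun i (x : ι → ℝ) => x i) P) (hU : UniformUpTo P N lam) {a b : ℝ}
    (ha : 0 ≤ a) (hab : a ≤ b) (hb0 : 0 < b) (hb : b ≤ lam) {W : Finset ι} (hN : N ⊆ W)
    {A : Set (ι → ℝ)} (hA : MeasurableSet A) (hup : IsUp N b A)
    (hAW : A ⊆ {x | lows Finset.univ lam x = W}) :
    wtIntegral P k N A b * wtIntegral P k N {x | lows Finset.univ lam x = W} a
      ≤ wtIntegral P k N {x | lows Finset.univ lam x = W} b * wtIntegral P k N A a := by
  have hm := measurableSet_lows_eq (Finset.univ : Finset ι) lam W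
  have hlam : 0 < lam := hb0.trans_le hb
  rw [wtIntegral_eq_sum_binWt hk hP hU ha hab hb0 hb hA hup,
    wtIntegral_eq_sum_binWt hk hP hU ha hab hb0 hb hm (isUp_lows_eq hb hN)]
  simp_rw [wtIntegral]
  rw [sum_powerset_eq_sum_range, sum_powerset_eq_sum_range,
    sum_powerset_eq_sum_range (g := fun v => binWt k v (a / b)),
    sum_powerset_eq_sum_range (g := fun v => binWt k v (a / b))]
  refine sum_mul_sum_le_of_ratio
    (fun v v' h _ => wt_mul_binWt_le hk (div_nonneg ha hb0.le) (div_le_one_of_le₀ hab hb0.le) h)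
    fun v v' h h' => ratio_mono hb0 (sub_nonneg.2 hb)
      (K := fun v => ∑ S ∈ N.powersetCard v, P.real (A ∩ {x | lows N b x = S}))
      (L := fun v => ∑ S ∈ N.powersetCard v,
        P.real ({x | lows Finset.univ lam x = W} ∩ {x | lows N b x = S}))
      (fun _ => Finset.sum_nonneg fun _ _ => measureReal_nonneg)
      (fun _ => Finset.sum_nonneg fun _ _ => measureReal_nonneg) ?_ ?_ h h'
  · intro v hv
    have hcount : ∀ S ∈ N.powersetCard v, ((N \ S).card : ℝ) = (N.card : ℝ) - v := fun S hS => by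
      obtain ⟨h1, h2⟩ := Finset.mem_powersetCard.1 hS
      rw [Finset.card_sdiff_of_subset h1, h2, Nat.cast_sub hv.le]
    calc _ = ∑ S ∈ N.powersetCard v, ∑ _i ∈ N \ S, b * P.real (A ∩ {x | lows N b x = S}) := by
          rw [Finset.mul_sum]
          refine Finset.sum_congr rfl fun S hS => ?_
          rw [Finset.sum_const, nsmul_eq_mul, hcount S hS]
          ring
      _ ≤ ∑ S ∈ N.powersetCard v, ∑ i ∈ N \ S,
            (lam - b) * P.real (A ∩ {x | lows N b x = insert i S}) := by
          refine Finset.sum_le_sum fun S _ => Finset.sum_le_sum fun i hi => ?_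
          rw [Finset.mem_sdiff] at hi
          refine measureReal_exchange hP hU hb0 hb hA (fun x hx j hj => ?_) hup hi.1 hi.2
          have hx' : lows Finset.univ lam x = W := hAW hx
          exact (mem_lows.1 (hx'.symm ▸ hN hj : j ∈ lows Finset.univ lam x)).2
      _ = _ := by
          rw [sum_powersetCard_insert N v
            fun S => (lam - b) * P.real (A ∩ {x | lows N b x = S}), ← Finset.mul_sum]
          ring
  · intro v hv
    -- On the whole event `v` is binomial with parameters `#N` and `b / lam`, so the growth bound is
    -- an equality.
    have hval : ∀ m, ∑ S ∈ N.powersetCard m,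
        P.real ({x | lows Finset.univ lam x = W} ∩ {x | lows N b x = S})
        = N.card.choose m * ((b / lam) ^ m * (1 - b / lam) ^ (N.card - m)
          * P.real {x | lows Finset.univ lam x = W}) := fun m => by
      rw [← Finset.card_powersetCard, ← nsmul_eq_mul, ← Finset.sum_const]
      refine Finset.sum_congr rfl fun S hS => ?_
      obtain ⟨h1, h2⟩ := Finset.mem_powersetCard.1 hS
      have := measureReal_thinning hP hU hb0.le hb hlam le_rfl hm (isUp_lows_eq le_rfl hN)
        (Finset.Subset.refl N) h1
      rw [inter_lows_eq_self hN, h2] at this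
      exact this
    simp only [hval]
    refine le_of_eq ?_
    have hc : (N.card.choose (v + 1) : ℝ) * (v + 1) = N.card.choose v * ((N.card : ℝ) - v) := by
      rw [← Nat.cast_sub hv.le]
      exact_mod_cast Nat.choose_succ_right_eq N.card v
    have hp : N.card - v = (N.card - (v + 1)) + 1 := by omega
    have hlb : lam - b = lam * (1 - b / lam) := by field_simp
    have hbl : b = lam * (b / lam) := by field_simp
    rw [hp, hlb]
    generalize b / lam = u at *
    subst hbl
    linear_combination (lam * (1 - u) * u ^ (v + 1) * (1 - u) ^ (N.card - (v + 1))
      * P.real {x | lows Finset.univ lam x = W}) * hc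

end Measure

/-! ### The step-up bound for fixed `W`, and summation over `W` -/

section StepUp

variable {ι : Type*} [Fintype ι] [DecidableEq ι] {P : Measure (ι → ℝ)} [IsProbabilityMeasure P]
  {N : Finset ι} {lam : ℝ}

/-- The `k`-FDR bound for a step-up procedure on the event that `W` is the set of coordinates at
most `lam`. -/
lemma sum_wtIntegral_sub_le {k n : ℕ} (hk : 1 ≤ k)
    (hP : iIndepFun (fun i (x : ι → ℝ) => x i) P) (hU : UniformUpTo P N lam) (hlam : 0 < lam)
    {W : Finset ι} (hN : N ⊆ W) (hNn : N.card ≤ n) {c : ℕ → ℝ} {γ : ℝ} (hγ : 0 ≤ γ)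
    (hc0 : ∀ r, 1 ≤ r → 0 < c r) (hcl : ∀ r, c r ≤ lam)
    (hcm : ∀ r, 1 ≤ r → c r ≤ c (r + 1))
    (hcG : ∀ r, 1 ≤ r → Gtilde k n (c r / lam) ≤ r * γ) :
    ∑ r ∈ Finset.Icc 1 W.card, (wtIntegral P k N (upperEvent lam c W r) (c r)
        - wtIntegral P k N (upperEvent lam c W (r + 1)) (c r)) / r
      ≤ γ * N.card * P.real {x | lows Finset.univ lam x = W} := by
  set ΩW : Set (ι → ℝ) := {x | lows Finset.univ lam x = W} with hΩ
  set A := upperEvent lam c W with hA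
  have hAW : ∀ r, A r ⊆ ΩW := fun r x hx => hx.1
  have hrhs : 0 ≤ γ * N.card * P.real ΩW := by positivity
  have hW : ∀ r, 1 ≤ r → wtIntegral P k N ΩW (c r) = binWt k N.card (c r / lam) * P.real ΩW :=
    fun r hr => wtIntegral_lows_eq hk hP hU (hc0 r hr).le (hcl r) hlam hN
  -- This disposes of `P.real ΩW = 0` and `N.card < k`, where the divisions below would fail.
  have hzero : (∀ r, 1 ≤ r → wtIntegral P k N ΩW (c r) = 0) →
      ∑ r ∈ Finset.Icc 1 W.card, (wtIntegral P k N (A r) (c r)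
        - wtIntegral P k N (A (r + 1)) (c r)) / r ≤ γ * N.card * P.real ΩW := fun h => by
    rw [Finset.sum_eq_zero]
    · exact hrhs
    · intro r hr
      have h0 := h r (Finset.mem_Icc.1 hr).1
      have e : ∀ s, wtIntegral P k N (A s) (c r) = 0 := fun s =>
        le_antisymm (h0 ▸ wtIntegral_mono P k N (hAW s) (c r)) (wtIntegral_nonneg _ _ _ _ _)
      rw [e, e, sub_zero, zero_div]
  rcases (measureReal_nonneg (μ := P) (s := ΩW)).eq_or_lt with hpw | hpw
  · exact hzero fun r hr => by rw [hW r hr, ← hpw, mul_zero]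
  rcases lt_or_ge N.card k with hM | hM
  · refine hzero fun r _ => Finset.sum_eq_zero fun T hT => ?_
    have := Finset.card_le_card (Finset.mem_powerset.1 hT)
    rw [wt, if_neg (by omega), zero_mul]
  set φ : ℕ → ℝ := fun r => binWt k N.card (c r / lam) with hφ
  have hu1 : ∀ r, c r / lam ≤ 1 := fun r => div_le_one_of_le₀ (hcl r) hlam.le
  have hMpos : (0 : ℝ) < N.card := by
    have : 0 < N.card := by omega
    exact_mod_cast this
  have hφpos : ∀ r, 1 ≤ r → 0 < φ r := fun r hr => by
    have hu := div_pos (hc0 r hr) hlam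
    have := G_pos (show k - 1 ≤ N.card - 1 by omega) hu (hu1 r)
    simp only [hφ, binWt]
    positivity
  have hφle : ∀ r, 1 ≤ r → φ r ≤ γ * N.card * r := fun r hr => by
    have hu := div_pos (hc0 r hr) hlam
    have h1 : G (k - 1) (N.card - 1) (c r / lam) ≤ G (k - 1) (n - 1) (c r / lam) :=
      G_mono_right (k - 1) hu.le (hu1 r) (by omega)
    have h2 := hcG r hr
    rw [Gtilde] at h2
    calc φ r ≤ N.card * (c r / lam * G (k - 1) (n - 1) (c r / lam)) := by
          simp only [hφ, binWt]
          gcongr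
      _ ≤ N.card * (r * γ) := mul_le_mul_of_nonneg_left h2 hMpos.le
      _ = _ := by ring
  set f : ℕ → ℝ := fun r => wtIntegral P k N (A r) (c r) / φ r with hf
  have hcmono : ∀ r s, 1 ≤ r → r ≤ s → c r ≤ c s := fun r s hr hrs => by
    induction s, hrs using Nat.le_induction with
    | base => exact le_rfl
    | succ s hs ih => exact ih.trans (hcm s (hr.trans hs))
  have hterm : ∀ r ∈ Finset.Icc 1 W.card, (wtIntegral P k N (A r) (c r)
      - wtIntegral P k N (A (r + 1)) (c r)) / r ≤ γ * N.card * (f r - f (r + 1)) := by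
    intro r hr
    have hr1 := (Finset.mem_Icc.1 hr).1
    have hr0 : (0 : ℝ) < r := by exact_mod_cast hr1
    have hsub : A (r + 1) ⊆ A r := by
      rintro x ⟨h1, s, hs, h2⟩
      exact ⟨h1, s, Finset.mem_Icc.2 ⟨(Nat.le_succ r).trans (Finset.mem_Icc.1 hs).1,
        (Finset.mem_Icc.1 hs).2⟩, h2⟩
    have hdiff : 0 ≤ wtIntegral P k N (A r) (c r) - wtIntegral P k N (A (r + 1)) (c r) :=
      sub_nonneg.2 (wtIntegral_mono P k N hsub (c r))
    have hkey := wtIntegral_mul_le hk hP hU (hc0 r hr1).le (hcm r hr1) (hc0 (r + 1) (by omega))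
      (hcl (r + 1)) hN (measurableSet_upperEvent lam c W (r + 1))
      (isUp_upperEvent (hcl (r + 1)) hN fun s hs => hcmono (r + 1) s (by omega) hs) (hAW (r + 1))
    rw [hW r hr1, hW (r + 1) (by omega)] at hkey
    -- The correlation inequality makes the sum telescope, by raising the threshold from `c r` to `c
    -- (r + 1)` on `A (r + 1)`.
    have hstep : f (r + 1) ≤ wtIntegral P k N (A (r + 1)) (c r) / φ r := by
      rw [hf, div_le_div_iff₀ (hφpos _ (by omega)) (hφpos r hr1)]
      refine le_of_mul_le_mul_right ?_ hpw
      simp only [hφ]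
      linarith
    calc _ ≤ γ * N.card * ((wtIntegral P k N (A r) (c r)
          - wtIntegral P k N (A (r + 1)) (c r)) / φ r) := by
          rw [← mul_div_assoc, div_le_div_iff₀ hr0 (hφpos r hr1)]
          have := mul_le_mul_of_nonneg_left (hφle r hr1) hdiff
          linarith
      _ ≤ _ := by
          rw [sub_div]
          refine mul_le_mul_of_nonneg_left ?_ (by positivity)
          simp only [hf] at hstep ⊢
          linarith
  refine (Finset.sum_le_sum hterm).trans ?_
  rw [← Finset.mul_sum]
  refine mul_le_mul_of_nonneg_left ?_ (by positivity)
  have htel : ∑ r ∈ Finset.Icc 1 W.card, (f r - f (r + 1)) = f 1 - f (W.card + 1) := by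
    have h1 : Finset.Icc 1 W.card = Finset.Ico 1 (W.card + 1) := by
      ext r
      simp only [Finset.mem_Icc, Finset.mem_Ico]
      omega
    rw [h1, Finset.sum_Ico_eq_sum_range, Nat.add_sub_cancel]
    have := Finset.sum_range_sub' (fun i => f (1 + i)) W.card
    rw [add_zero, add_comm 1 W.card] at this
    rw [← this]
    exact Finset.sum_congr rfl fun i _ => by rw [add_assoc]
  rw [htel]
  have hlast : 0 ≤ f (W.card + 1) :=
    div_nonneg (wtIntegral_nonneg _ _ _ _ _) (hφpos _ (by omega)).le
  have hfirst : f 1 ≤ P.real ΩW := by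
    rw [hf, div_le_iff₀ (hφpos 1 le_rfl)]
    refine (wtIntegral_mono P k N (hAW 1) (c 1)).trans_eq ?_
    rw [hW 1 le_rfl, mul_comm]
  linarith

lemma measureReal_lows_eq (hP : iIndepFun (fun i (x : ι → ℝ) => x i) P)
    (hU : UniformUpTo P N lam) (hlam : 0 ≤ lam) {S : Finset ι} (hS : S ⊆ N) :
    P.real {x | lows N lam x = S} = lam ^ S.card * (1 - lam) ^ (N.card - S.card) := by
  have e : {x : ι → ℝ | lows N lam x = S}
      = {x | ∀ i ∈ N, x i ∈ if i ∈ S then Set.Iic lam else Set.Ioi lam} ∩ Set.univ := by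
    ext x
    simp only [Set.inter_univ, Set.mem_ofPred_eq, Finset.ext_iff, mem_lows]
    constructor
    · intro h i hi
      split_ifs with hiS
      · exact ((h i).2 hiS).2
      · exact not_le.1 fun hle => hiS ((h i).1 ⟨hi, hle⟩)
    · intro h i
      constructor
      · rintro ⟨hi, hle⟩
        have := h i hi
        split_ifs at this with hiS
        · exact hiS
        · exact absurd hle (not_le.2 this)
      · intro hiS
        have := h i (hS hiS)
        rw [if_pos hiS] at this
        exact ⟨hS hiS, this⟩
  have hi : ∀ i ∈ N, P.real {x : ι → ℝ | x i ∈ if i ∈ S then Set.Iic lam else Set.Ioi lam}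
      = if i ∈ S then lam else 1 - lam := fun i hi => by
    split_ifs with h
    · exact hU i hi lam hlam le_rfl
    · have hc : {x : ι → ℝ | x i ∈ Set.Ioi lam} = {x | x i ≤ lam}ᶜ := by
        ext x
        simp
      rw [hc, probReal_compl_eq_one_sub
        (measurableSet_le (measurable_pi_apply i) measurable_const), hU i hi lam hlam le_rfl]
  rw [e, measureReal_box_inter hP N (fun i => by split_ifs <;> measurability) MeasurableSet.univ
    (fun _ _ _ _ => trivial), Finset.prod_congr rfl hi, Finset.prod_ite, Finset.prod_const,
    Finset.prod_const, Finset.filter_mem_eq_inter, Finset.inter_eq_right.2 hS,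
    Finset.filter_notMem_eq_sdiff, Finset.card_sdiff_of_subset hS, probReal_univ, mul_one]

/-- The set of low coordinates in `N` is `W ∩ N`, so the sum over `W` may be grouped by it. -/
lemma sum_measureReal_mul_inter (N : Finset ι) (lam : ℝ) (g : Finset ι → ℝ) :
    ∑ W : Finset ι, g (W ∩ N) * P.real {x : ι → ℝ | lows Finset.univ lam x = W}
      = ∑ S ∈ N.powerset, g S * P.real {x : ι → ℝ | lows N lam x = S} := by
  have h1 : ∀ W : Finset ι, g (W ∩ N) * P.real {x : ι → ℝ | lows Finset.univ lam x = W}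
      = ∑ S ∈ N.powerset,
        g S * P.real ({x | lows N lam x = S} ∩ {x : ι → ℝ | lows Finset.univ lam x = W}) := by
    intro W
    rw [← sum_measureReal_inter_lows (N := N) (measurableSet_lows_eq Finset.univ lam W) lam,
      Finset.mul_sum]
    refine Finset.sum_congr rfl fun S _ => ?_
    rw [Set.inter_comm]
    rcases Set.eq_empty_or_nonempty
      ({x : ι → ℝ | lows N lam x = S} ∩ {x | lows Finset.univ lam x = W}) with h | ⟨x, hx1, hx2⟩
    · rw [h, measureReal_empty, mul_zero, mul_zero]
    · congr 2
      have e1 : lows N lam x = S := hx1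
      have e2 : lows Finset.univ lam x = W := hx2
      rw [← e1, ← e2]
      ext i
      simp [mem_lows, and_comm]
  simp_rw [h1]
  rw [Finset.sum_comm]
  refine Finset.sum_congr rfl fun S _ => ?_
  rw [← Finset.mul_sum, ← Finset.powerset_univ,
    sum_measureReal_inter_lows (measurableSet_lows_eq N lam S)]

end StepUp

lemma crit_eq (k n : ℕ) (α lam : ℝ) (i j : ℕ) :
    crit k n α lam i j
      = lam * cappedInv k n (i * (α * (1 - lam) / (lam * ((n : ℝ) - j + 1)))) := by
  rw [crit, cappedInv, ← mul_div_assoc, ← mul_assoc]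

/-! ### The bound under the law of the p-values -/

section Law

variable {n k : ℕ} {α lam : ℝ} {P : Measure (Fin n → ℝ)} [IsProbabilityMeasure P]
  {nulls : Finset (Fin n)}

lemma integrable_and_integral_kFDP_le (hk : 1 ≤ k) (hkn : k ≤ n) (hα : 0 < α)
    (hlam : lam ∈ Set.Ioo (0 : ℝ) 1) (hP : iIndepFun (fun i (x : Fin n → ℝ) => x i) P)
    (hU : UniformUpTo P nulls lam) :
    Integrable (fun x => kFDP k nulls (rejected k α lam x)) P ∧
      ∫ x, kFDP k nulls (rejected k α lam x) ∂P ≤ α := by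
  classical
  obtain ⟨hl0, hl1⟩ := hlam
  have hl1' : 0 < 1 - lam := by linarith
  set γ : ℕ → ℝ := fun j => α * (1 - lam) / (lam * ((n : ℝ) - j + 1)) with hγ
  have hden : ∀ j ≤ n, 0 < (n : ℝ) - j + 1 := fun j hj => by
    have : (j : ℝ) ≤ n := by exact_mod_cast hj
    linarith
  have hγ0 : ∀ j ≤ n, 0 < γ j := fun j hj => by
    have := hden j hj
    simp only [hγ]
    positivity
  have hcap : ∀ r j, crit k n α lam r j = lam * cappedInv k n (r * γ j) := fun r j =>
    crit_eq k n α lam r j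
  have hy0 : ∀ j ≤ n, ∀ r : ℕ, 1 ≤ r → 0 < (r : ℝ) * γ j := fun j hj r hr =>
    mul_pos (by exact_mod_cast hr) (hγ0 j hj)
  have hmono : ∀ j ≤ n, ∀ r, 1 ≤ r → crit k n α lam r j ≤ crit k n α lam (r + 1) j :=
    fun j hj r hr => by
      rw [hcap, hcap]
      refine mul_le_mul_of_nonneg_left (cappedInv_mono hkn (hy0 j hj r hr) ?_) hl0.le
      refine mul_le_mul_of_nonneg_right ?_ (hγ0 j hj).le
      push_cast
      linarith
  have hle : ∀ j r, crit k n α lam r j ≤ lam := fun j r => by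
    rw [hcap]
    exact mul_le_of_le_one_right hl0.le (cappedInv_le_one _ _ _)
  have hcard : ∀ W : Finset (Fin n), W.card ≤ n := fun W => by
    simpa using Finset.card_le_univ W
  set c : Finset (Fin n) → ℕ → ℝ := fun W s => crit k n α lam s W.card with hc
  set E : Finset (Fin n) → ℕ → Finset (Fin n) → Set (Fin n → ℝ) := fun W r T =>
    (upperEvent lam (c W) W r \ upperEvent lam (c W) W (r + 1)) ∩
      {x | lows (W ∩ nulls) (c W r) x = T} with hE
  have hEm : ∀ W r T, MeasurableSet (E W r T) := fun W r T =>
    ((measurableSet_upperEvent _ _ _ _).diff (measurableSet_upperEvent _ _ _ _)).inter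
      (measurableSet_lows_eq _ _ _)
  have hfun : (fun x => kFDP k nulls (rejected k α lam x)) = fun x =>
      ∑ W : Finset (Fin n), ∑ r ∈ Finset.Icc 1 W.card, ∑ T ∈ (W ∩ nulls).powerset,
        (E W r T).indicator (fun _ => wt k T.card / r) x :=
    funext fun x => kFDP_rejected_eq nulls hmono hle x
  have hint : ∀ W r T, Integrable ((E W r T).indicator fun _ => wt k T.card / (r : ℝ)) P :=
    fun W r T => (integrable_const _).indicator (hEm W r T)
  have hslice : ∀ W r, ∑ T ∈ (W ∩ nulls).powerset, P.real (E W r T) * (wt k T.card / r)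
      = (wtIntegral P k (W ∩ nulls) (upperEvent lam (c W) W r) (c W r)
        - wtIntegral P k (W ∩ nulls) (upperEvent lam (c W) W (r + 1)) (c W r)) / r := by
    intro W r
    rw [wtIntegral, wtIntegral, ← Finset.sum_sub_distrib, Finset.sum_div]
    refine Finset.sum_congr rfl fun T _ => ?_
    have hd : P.real (E W r T)
        = P.real (upperEvent lam (c W) W r ∩ {x | lows (W ∩ nulls) (c W r) x = T})
          - P.real (upperEvent lam (c W) W (r + 1) ∩ {x | lows (W ∩ nulls) (c W r) x = T}) := by
      rw [← measureReal_sdiff _ ((measurableSet_upperEvent _ _ _ _).inter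
        (measurableSet_lows_eq _ _ _)), ← Set.inter_sdiff_distrib_right]
      refine Set.inter_subset_inter_left _ ?_
      rintro x ⟨h1, s, hs, h2⟩
      exact ⟨h1, s, Finset.mem_Icc.2 ⟨(Nat.le_succ r).trans (Finset.mem_Icc.1 hs).1,
        (Finset.mem_Icc.1 hs).2⟩, h2⟩
    rw [hd]
    ring
  rw [hfun]
  refine ⟨integrable_finsetSum _ fun W _ => integrable_finsetSum _ fun r _ =>
    integrable_finsetSum _ fun T _ => hint W r T, ?_⟩
  have hval : ∫ x, ∑ W : Finset (Fin n), ∑ r ∈ Finset.Icc 1 W.card, ∑ T ∈ (W ∩ nulls).powerset,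
        (E W r T).indicator (fun _ => wt k T.card / (r : ℝ)) x ∂P
      = ∑ W : Finset (Fin n), ∑ r ∈ Finset.Icc 1 W.card, ∑ T ∈ (W ∩ nulls).powerset,
        P.real (E W r T) * (wt k T.card / r) := by
    rw [integral_finsetSum _ fun W _ => integrable_finsetSum _ fun r _ =>
      integrable_finsetSum _ fun T _ => hint W r T]
    refine Finset.sum_congr rfl fun W _ => ?_
    rw [integral_finsetSum _ fun r _ => integrable_finsetSum _ fun T _ => hint W r T]
    refine Finset.sum_congr rfl fun r _ => ?_
    rw [integral_finsetSum _ fun T _ => hint W r T]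
    refine Finset.sum_congr rfl fun T _ => ?_
    rw [integral_indicator_const _ (hEm W r T), smul_eq_mul]
  rw [hval]
  simp_rw [hslice]
  set g : Finset (Fin n) → ℝ := fun S =>
    α / lam * ((S.card : ℝ) * ((1 - lam) / ((nulls.card : ℝ) - S.card + 1))) with hg
  have hWle : ∀ W : Finset (Fin n), ∑ r ∈ Finset.Icc 1 W.card,
      (wtIntegral P k (W ∩ nulls) (upperEvent lam (c W) W r) (c W r)
        - wtIntegral P k (W ∩ nulls) (upperEvent lam (c W) W (r + 1)) (c W r)) / r
      ≤ g (W ∩ nulls) * P.real {x : Fin n → ℝ | lows Finset.univ lam x = W} := by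
    intro W
    have hWn := hcard W
    have hU' : UniformUpTo P (W ∩ nulls) lam := fun i hi => hU i (Finset.mem_inter.1 hi).2
    refine (sum_wtIntegral_sub_le hk hP hU' hl0 Finset.inter_subset_left (hcard _)
      (hγ0 W.card hWn).le ?_ (fun r => hle _ r) (fun r hr => hmono _ hWn r hr) ?_).trans ?_
    · intro r hr
      simp only [hcap]
      exact mul_pos hl0 (cappedInv_pos hkn (hy0 _ hWn r hr))
    · intro r hr
      simp only [hcap]
      rw [mul_div_cancel_left₀ _ hl0.ne']
      exact Gtilde_cappedInv_le hkn (hy0 _ hWn r hr)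
    · refine mul_le_mul_of_nonneg_right ?_ measureReal_nonneg
      -- The nulls outside `W` number at most `n - W.card`. This makes `n - W.card + 1` a safe
      -- denominator.
      have hcount : W.card + nulls.card ≤ n + (W ∩ nulls).card := by
        rw [← Finset.card_union_add_card_inter]
        exact Nat.add_le_add_right (hcard _) _
      have hcount' : (W.card : ℝ) + nulls.card ≤ n + (W ∩ nulls).card := by exact_mod_cast hcount
      have hsub : ((W ∩ nulls).card : ℝ) ≤ nulls.card := by
        exact_mod_cast Finset.card_le_card Finset.inter_subset_right
      have hd : 0 < (nulls.card : ℝ) - (W ∩ nulls).card + 1 := by linarith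
      have hfrac : (1 - lam) / ((n : ℝ) - W.card + 1)
          ≤ (1 - lam) / ((nulls.card : ℝ) - (W ∩ nulls).card + 1) :=
        div_le_div_of_nonneg_left hl1'.le hd (by linarith)
      have hγe : γ W.card = α / lam * ((1 - lam) / ((n : ℝ) - W.card + 1)) := by
        simp only [hγ]
        rw [div_mul_div_comm]
      rw [hγe]
      simp only [hg]
      have := mul_le_mul_of_nonneg_left hfrac
        (show 0 ≤ α / lam * ((W ∩ nulls).card : ℝ) by positivity)
      linarith
  refine (Finset.sum_le_sum fun W _ => hWle W).trans ?_
  rw [sum_measureReal_mul_inter]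
  calc _ = α / lam * ∑ S ∈ nulls.powerset, lam ^ S.card * (1 - lam) ^ (nulls.card - S.card)
          * ((S.card : ℝ) * ((1 - lam) / ((nulls.card : ℝ) - S.card + 1))) := by
        rw [Finset.mul_sum]
        refine Finset.sum_congr rfl fun S hS => ?_
        rw [measureReal_lows_eq hP hU hl0.le (Finset.mem_powerset.1 hS)]
        simp only [hg]
        ring
    _ ≤ α / lam * lam :=
        mul_le_mul_of_nonneg_left (sum_powerset_ratio_le nulls hl0.le hl1) (by positivity)
    _ = α := div_mul_cancel₀ _ hl0.ne'

end Law

/-! ### Transfer to the original probability space -/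

lemma measureReal_le_of_isUniform {Ω : Type*} [MeasurableSpace Ω] {μ : Measure Ω} {X : Ω → ℝ}
    (hX : pdf.IsUniform X (Set.Ioo 0 1) μ volume) {t : ℝ} (h0 : 0 ≤ t) (h1 : t < 1) :
    μ.real (X ⁻¹' Set.Iic t) = t := by
  have hv : (volume (Set.Ioo (0 : ℝ) 1)) = 1 := by simp
  rw [measureReal_def, hX.measure_preimage (by simp) (by simp) measurableSet_Iic, hv, div_one]
  have : Set.Ioo (0 : ℝ) 1 ∩ Set.Iic t = Set.Ioc 0 t := by
    ext s
    simp only [Set.mem_inter_iff, Set.mem_Ioo, Set.mem_Iic, Set.mem_Ioc]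
    constructor
    · rintro ⟨⟨h, _⟩, h'⟩
      exact ⟨h, h'⟩
    · rintro ⟨h, h'⟩
      exact ⟨⟨h, h'.trans_lt h1⟩, h'⟩
  rw [this, Real.volume_Ioc, sub_zero, ENNReal.toReal_ofReal h0]

end KFDR

theorem theorem4p2 {Ω : Type*} [MeasurableSpace Ω] (μ : Measure Ω) [IsProbabilityMeasure μ]
    (n k : ℕ) (hk : 1 ≤ k) (hkn : k ≤ n)
    (α : ℝ) (hα : 0 < α) (lam : ℝ) (hlam : lam ∈ Set.Ioo (0 : ℝ) 1)
    (p : Fin n → Ω → ℝ) (hmeas : ∀ i, Measurable (p i)) (hindep : iIndepFun p μ)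
    (nulls : Finset (Fin n))
    (hnull : ∀ i ∈ nulls, pdf.IsUniform (p i) (Set.Ioo 0 1) μ volume) :
    KFDR.ControlsKFDR μ k α nulls p (KFDR.rejected k α lam) := by
  have hp : Measurable fun ω i => p i ω := measurable_pi_iff.2 hmeas
  set P : Measure (Fin n → ℝ) := μ.map fun ω i => p i ω with hPdef
  have : IsProbabilityMeasure P := Measure.isProbabilityMeasure_map hp.aemeasurable
  have hP : iIndepFun (fun i (x : Fin n → ℝ) => x i) P := by
    rw [iIndepFun_iff_map_fun_eq_pi_map fun i => (measurable_pi_apply i).aemeasurable]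
    have h1 : P.map (fun x i => x i) = P := Measure.map_id
    have h2 : ∀ i, P.map (fun x => x i) = μ.map (p i) := fun i =>
      Measure.map_map (measurable_pi_apply i) hp
    simp only [h1, h2]
    exact (iIndepFun_iff_map_fun_eq_pi_map fun i => (hmeas i).aemeasurable).1 hindep
  have hU : KFDR.UniformUpTo P nulls lam := fun i hi t h0 ht => by
    rw [hPdef, map_measureReal_apply hp
      (measurableSet_le (measurable_pi_apply i) measurable_const)]
    exact KFDR.measureReal_le_of_isUniform (hnull i hi) h0 (ht.trans_lt hlam.2)
  obtain ⟨h1, h2⟩ := KFDR.integrable_and_integral_kFDP_le hk hkn hα hlam hP hU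
  refine ⟨h1.comp_measurable hp, ?_⟩
  rw [hPdef, integral_map hp.aemeasurable h1.aestronglyMeasurable] at h2
  exact h2
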